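/- Let $n\ge 1$ be an integer and $\beta>0$. Let $\omega_n$ be the volume of the Euclidean unit ball of $\mathbb R^n$ and $k_n=\left(\frac{1}{n!\,\omega_n}\right)^{1/n}$. For a Lipschitz function $f:\mathbb R^n\to\mathbb R$ (differentiable almost everywhere) and $\xi\in\mathbb S^{n-1}$, let $\|\nabla_\xi f\|_\infty$ be the essential supremum of $x\mapsto|\nabla f(x)\cdot\xi|$, and let $$\mathcal E_\infty(f)=(n\omega_n)^{1/n}\left(\int_{\mathbb S^{n-1}}\|\nabla_\xi f\|_\infty^{-n}\,d\xi\right)^{-1/n},$$ where $d\xi$ is the surface measure on the unit sphere $\mathbb S^{n-1}$ (counting measure on $\{-1,1\}$ if $n=1$). Then for every Lipschitz function $f:\mathbb R^n\to\mathbb R$ with $\int_{\mathbb R^n}e^{\beta f}\,dx=1$, the positive part of $e^{\beta f}\log e^{\beta f}$ is integrable, so that $\operatorname{Ent}(e^{\beta f})=\int_{\mathbb R^n}e^{\beta f}\log e^{\beta f}\,dx$ is well defined in $[-\infty,\infty)$; moreover $0<\mathcal E_\infty(f)<\infty$, and $$\operatorname{Ent}(e^{\beta f})\le n\log\left(\frac{\beta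 k_n}{e}\,\mathcal E_\infty(f)\right).$$ Equality holds for every function of the form $f(x)=c-b|Ax-a|$ with $a\in\mathbb R^n$, $b>0$, $c\in\mathbb R$ and $A\in SL_n(\mathbb R)$ that is normalized by $\int_{\mathbb R^n}e^{\beta f}\,dx=1$. -/

import Mathlib

open MeasureTheory
open scoped ENNReal

noncomputable section

namespace AffineLogSobolev

/-- `∫ g log g dx` over `ℝⁿ`, the positive part of the integrand minus its negative part, as an
extended real number (for a Lipschitz `f` with `∫ e^{βf} = 1` the entropy of `e^{βf}` can be `-∞`).
It is meaningful when at least one of the two parts is finite. -/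
def Ent {n : ℕ} (g : EuclideanSpace ℝ (Fin n) → ℝ) : EReal :=
  ((∫⁻ x, ENNReal.ofReal (g x * Real.log (g x)) : ℝ≥0∞) : EReal) -
    ((∫⁻ x, ENNReal.ofReal (-(g x * Real.log (g x))) : ℝ≥0∞) : EReal)

/-- The volume `ω_n` of the Euclidean unit ball of `ℝⁿ`. -/
def omega (n : ℕ) : ℝ :=
  (volume (Metric.ball (0 : EuclideanSpace ℝ (Fin n)) 1)).toReal

/-- `k_n = (1 / (n! ω_n))^{1/n}`. -/
def k (n : ℕ) : ℝ :=
  (1 / ((n.factorial : ℝ) * omega n)) ^ (1 / (n : ℝ))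

/-- `‖∇_ξ f‖_∞`, the essential supremum of `|∇f(x) · ξ|` over `x ∈ ℝⁿ`. A Lipschitz function is
differentiable almost everywhere, and the values of `gradient f` on the remaining null set are
irrelevant. -/
def dirGradNorm {n : ℕ} (f : EuclideanSpace ℝ (Fin n) → ℝ) (ξ : EuclideanSpace ℝ (Fin n)) :
    ℝ≥0∞ :=
  eLpNorm (fun x => inner ℝ (gradient f x) ξ) ∞ volume

/-- The `L_∞` affine energy
`𝓔_∞(f) = (n ω_n)^{1/n} (∫_{S^{n-1}} ‖∇_ξ f‖_∞^{-n} dξ)^{-1/n}`,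
where `dξ` is the surface measure of the unit sphere. -/
def affineEnergy {n : ℕ} (f : EuclideanSpace ℝ (Fin n) → ℝ) : ℝ≥0∞ :=
  ENNReal.ofReal (((n : ℝ) * omega n) ^ (1 / (n : ℝ))) *
    (∫⁻ ξ : Metric.sphere (0 : EuclideanSpace ℝ (Fin n)) 1,
      dirGradNorm f (ξ : EuclideanSpace ℝ (Fin n)) ^ (-(n : ℝ))
        ∂(volume : Measure (EuclideanSpace ℝ (Fin n))).toSphere) ^ (-(1 / (n : ℝ)))

end AffineLogSobolev

end

namespace AffineLogSobolev

open scoped Pointwise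

/-! ### The Prékopa–Leindler inequality -/

/-! For Lipschitz `f`, the map `ξ ↦ ‖∇_ξ f‖_∞` is a seminorm, and `f` is 1-Lipschitz with respect to
it (`abs_sub_le_gradSeminorm`). Put `u = βf` and let `p` be `β` times this seminorm. Integrating in
polar coordinates gives `∫ e^{-p} = (n-1)! ∫_{S^{n-1}} p^{-n}`, so the right-hand side of the
theorem equals `-n - log ∫ e^{-p}` (`affineEnergy_spec`). The claim becomes a statement about a
`p`-Lipschitz `u` with `∫ e^u = 1`, namely `∫ u e^u ≤ -n - log ∫ e^{-p}`.

This is an infinitesimal Prékopa–Leindler inequality. Applied to rescalings of `e^u` and `e^{-p}`,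
Prékopa–Leindler bounds `log ∫ e^{θu}` from below by `-n log θ + θ log ∫ e^u + (1-θ) log ∫ e^{-p}`
for `0 < θ < 1` (`log_integral_exp_mul_ge`). Both sides agree at `θ = 1`, so comparing left
derivatives there yields the entropy bound. Differentiation needs `e^{θu}` integrable near `θ = 1`;
this holds for the truncations `min u (k - p)`, and dominated convergence removes the truncation.

The Lipschitz bound also gives `e^{u(x)} ∫ e^{-p} ≤ ∫ e^u`. Hence `e^{-p}` is integrable, which
makes the energy positive and finite, and `u` is bounded above, which controls the positive part of
the entropy. For `f = c - q(· - x₀)` with `q` a norm, the gradient seminorm is `q` itself, and `∫ p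
e^{-p} = n ∫ e^{-p}` gives equality. -/

lemma volume_add_le_of_isCompact {K L C : Set ℝ} (hK : IsCompact K) (hL : IsCompact L)
    (hK0 : K.Nonempty) (hL0 : L.Nonempty) (h : ∀ x ∈ K, ∀ y ∈ L, x + y ∈ C) :
    volume K + volume L ≤ volume C := by
  have hp := hK.sSup_mem hK0
  have hq := hL.sInf_mem hL0
  set p := sSup K
  set q := sInf L
  have h1 : volume ((fun x => x + q) '' K) = volume K := by
    rw [Set.image_add_right, measure_preimage_add_right]
  have h2 : volume ((fun x => p + x) '' L) = volume L := by
    rw [Set.image_add_left, measure_preimage_add]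
  have hm : MeasurableSet ((fun x => p + x) '' L) :=
    (hL.image (by fun_prop)).measurableSet
  -- The translates `K + inf L` and `sup K + L` both lie in `C` and can meet only at `sup K + inf
  -- L`.
  have hd : AEDisjoint volume ((fun x => x + q) '' K) ((fun x => p + x) '' L) := by
    refine measure_mono_null (t := {p + q}) ?_ (measure_singleton _)
    rintro z ⟨⟨x, hx, rfl⟩, ⟨y, hy, hxy⟩⟩
    have hxp : x ≤ p := le_csSup hK.bddAbove hx
    have hyq : q ≤ y := csInf_le hL.bddBelow hy
    simp only [Set.mem_singleton_iff] at *
    linarith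
  rw [← h1, ← h2, ← measure_union₀ hm.nullMeasurableSet hd]
  refine measure_mono (Set.union_subset ?_ ?_)
  · rintro _ ⟨x, hx, rfl⟩
    exact h x hx q hq
  · rintro _ ⟨x, hx, rfl⟩
    exact h p hp x hx

/-- The one-dimensional Brunn–Minkowski inequality. -/
lemma volume_add_le {A B C : Set ℝ} (hA : MeasurableSet A) (hB : MeasurableSet B)
    (hA0 : A.Nonempty) (hB0 : B.Nonempty) (h : ∀ x ∈ A, ∀ y ∈ B, x + y ∈ C) :
    volume A + volume B ≤ volume C := by
  obtain ⟨a, ha⟩ := hA0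
  obtain ⟨b, hb⟩ := hB0
  rw [hA.measure_eq_iSup_isCompact, hB.measure_eq_iSup_isCompact]
  simp only [iSup_and']
  have : Nonempty {K : Set ℝ // K ⊆ A ∧ IsCompact K} := ⟨⟨∅, by simp⟩⟩
  have : Nonempty {K : Set ℝ // K ⊆ B ∧ IsCompact K} := ⟨⟨∅, by simp⟩⟩
  rw [iSup_subtype', iSup_subtype']
  refine ENNReal.iSup_add_iSup_le fun K L => ?_
  obtain ⟨K, hKA, hK⟩ := K
  obtain ⟨L, hLB, hL⟩ := L
  -- The approximating compact sets may be empty; adjoining a point of each set restores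
  -- nonemptiness.
  calc volume K + volume L ≤ volume (insert a K) + volume (insert b L) := by
        gcongr <;> exact Set.subset_insert _ _
    _ ≤ volume C := by
        refine volume_add_le_of_isCompact (hK.insert a) (hL.insert b) (Set.insert_nonempty _ _)
          (Set.insert_nonempty _ _) fun x hx y hy => h x ?_ y ?_
        · exact Set.insert_subset ha hKA hx
        · exact Set.insert_subset hb hLB hy

lemma geom_mean_le_arith_mean_ennreal {θ : ℝ} (h0 : 0 < θ) (h1 : θ < 1) (a b : ℝ≥0∞) :
    a ^ θ * b ^ (1 - θ) ≤ ENNReal.ofReal θ * a + ENNReal.ofReal (1 - θ) * b := by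
  have h1' : 0 < 1 - θ := by linarith
  rcases eq_or_ne a ⊤ with rfl | ha
  · rw [ENNReal.mul_top (by simpa using h0)]; simp
  rcases eq_or_ne b ⊤ with rfl | hb
  · rw [ENNReal.mul_top (by simpa using h1')]; simp
  lift a to NNReal using ha
  lift b to NNReal using hb
  have := NNReal.geom_mean_le_arith_mean2_weighted ⟨θ, h0.le⟩ ⟨1 - θ, h1'.le⟩ a b
    (NNReal.eq (add_sub_cancel θ 1))
  rw [← ENNReal.coe_rpow_of_nonneg _ h0.le, ← ENNReal.coe_rpow_of_nonneg _ h1'.le,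
    ENNReal.ofReal_eq_coe_nnreal h0.le, ENNReal.ofReal_eq_coe_nnreal h1'.le]
  exact_mod_cast this

/-- The Prékopa–Leindler inequality for the measure `μ`. -/
def PrekopaLeindler {E : Type*} [AddCommGroup E] [Module ℝ E] [MeasurableSpace E]
    (μ : Measure E) : Prop :=
  ∀ θ : ℝ, 0 < θ → θ < 1 → ∀ f g h : E → ℝ≥0∞, Measurable f → Measurable g → Measurable h →
    (∀ x y, f x ^ θ * g y ^ (1 - θ) ≤ h (θ • x + (1 - θ) • y)) →
    (∫⁻ x, f x ∂μ) ^ θ * (∫⁻ x, g x ∂μ) ^ (1 - θ) ≤ ∫⁻ x, h x ∂μ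

lemma lintegral_eq_lintegral_Ioo_meas_lt {f : ℝ → ℝ≥0∞} (hf : Measurable f) (h1 : ∀ x, f x ≤ 1) :
    ∫⁻ x, f x = ∫⁻ t in Set.Ioo (0 : ℝ) 1, volume {x | ENNReal.ofReal t < f x} := by
  have hfin : ∀ x, f x ≠ ⊤ := fun x => ne_top_of_le_ne_top ENNReal.one_ne_top (h1 x)
  have key := lintegral_eq_lintegral_meas_lt (volume : Measure ℝ) (f := fun x => (f x).toReal)
    (Filter.Eventually.of_forall fun x => ENNReal.toReal_nonneg) hf.ennreal_toReal.aemeasurable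
  simp only [ENNReal.ofReal_toReal (hfin _)] at key
  rw [key, ← Set.Ioo_union_Ici_eq_Ioi (zero_lt_one' ℝ),
    lintegral_union measurableSet_Ici (by
      rw [Set.disjoint_left]; intro x hx hx'; exact absurd hx.2 (not_lt.2 hx'))]
  have h2 : ∫⁻ t in Set.Ici (1 : ℝ), volume {x | t < (f x).toReal} = 0 := by
    rw [setLIntegral_congr_fun (g := fun _ => 0) measurableSet_Ici]
    · simp
    · intro t ht
      have : {x | t < (f x).toReal} = ∅ := by
        ext x
        simp only [Set.mem_ofPred_eq, Set.mem_empty_iff_false, iff_false, not_lt]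
        exact (ENNReal.toReal_mono ENNReal.one_ne_top (h1 x)).trans (by simpa using ht)
      simp [this]
  rw [h2, add_zero]
  refine setLIntegral_congr_fun measurableSet_Ioo fun t ht => ?_
  simp only [ENNReal.ofReal_lt_iff_lt_toReal ht.1.le (hfin _)]

/-- Once both suprema are 1, the superlevel sets of `f` and `g` at any height `t < 1` are nonempty,
and `{h > t}` contains `θ{f > t} + (1-θ){g > t}`. One-dimensional Brunn–Minkowski at each height and
the layer-cake formula then give a bound by the arithmetic mean, stronger than the geometric one. -/
lemma lintegral_arith_mean_le_of_iSup_eq_one {θ : ℝ} (h0 : 0 < θ) (h1 : θ < 1)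
    {f g h : ℝ → ℝ≥0∞} (hf : Measurable f) (hg : Measurable g) (hh : Measurable h)
    (hf1 : ⨆ x, f x = 1) (hg1 : ⨆ x, g x = 1)
    (hle : ∀ x y, f x ^ θ * g y ^ (1 - θ) ≤ h (θ • x + (1 - θ) • y)) :
    ENNReal.ofReal θ * (∫⁻ x, f x) + ENNReal.ofReal (1 - θ) * (∫⁻ x, g x) ≤ ∫⁻ x, h x := by
  have h1' : 0 < 1 - θ := by linarith
  have hfl : ∀ x, f x ≤ 1 := fun x => hf1 ▸ le_iSup f x
  have hgl : ∀ x, g x ≤ 1 := fun x => hg1 ▸ le_iSup g x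
  have hh' : Measurable fun x => min (h x) 1 := hh.min measurable_const
  calc _ ≤ ∫⁻ x, min (h x) 1 := ?_
    _ ≤ _ := lintegral_mono fun x => min_le_left _ _
  rw [lintegral_eq_lintegral_Ioo_meas_lt hf hfl, lintegral_eq_lintegral_Ioo_meas_lt hg hgl,
    lintegral_eq_lintegral_Ioo_meas_lt hh' (fun x => min_le_right _ _),
    ← lintegral_const_mul' _ _ ENNReal.ofReal_ne_top,
    ← lintegral_const_mul' _ _ ENNReal.ofReal_ne_top]
  -- Monotonicity in `t` supplies the measurability needed to add the two integrals.
  have hanti : Antitone fun t : ℝ => ENNReal.ofReal (1 - θ) * volume {x | ENNReal.ofReal t < g x} :=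
    fun s t hst => by
      dsimp only
      gcongr
  rw [← lintegral_add_right _ hanti.measurable]
  refine setLIntegral_mono' measurableSet_Ioo fun t ht => ?_
  set A := {x | ENNReal.ofReal t < f x}
  set B := {x | ENNReal.ofReal t < g x}
  have hA : MeasurableSet A := measurableSet_lt measurable_const hf
  have hB : MeasurableSet B := measurableSet_lt measurable_const hg
  have ht1 : ENNReal.ofReal t < 1 := by simpa using ht.2
  have hA0 : A.Nonempty := by
    obtain ⟨x, hx⟩ := lt_iSup_iff.1 (hf1 ▸ ht1 : ENNReal.ofReal t < ⨆ x, f x)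
    exact ⟨x, hx⟩
  have hB0 : B.Nonempty := by
    obtain ⟨x, hx⟩ := lt_iSup_iff.1 (hg1 ▸ ht1 : ENNReal.ofReal t < ⨆ x, g x)
    exact ⟨x, hx⟩
  have e1 : ENNReal.ofReal θ * volume A = volume (θ • A) := by
    rw [Measure.addHaar_smul]; simp [abs_of_pos h0]
  have e2 : ENNReal.ofReal (1 - θ) * volume B = volume ((1 - θ) • B) := by
    rw [Measure.addHaar_smul]; simp [abs_of_pos h1']
  rw [e1, e2]
  refine volume_add_le (hA.const_smul₀ θ) (hB.const_smul₀ _) hA0.smul_set hB0.smul_set ?_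
  rintro _ ⟨x, hx, rfl⟩ _ ⟨y, hy, rfl⟩
  refine lt_min ((?_ : _ < _).trans_le (hle x y)) ht1
  have hx' : ENNReal.ofReal t ^ θ < f x ^ θ := ENNReal.rpow_lt_rpow hx h0
  have hy' : ENNReal.ofReal t ^ (1 - θ) < g y ^ (1 - θ) := ENNReal.rpow_lt_rpow hy h1'
  calc ENNReal.ofReal t = ENNReal.ofReal t ^ θ * ENNReal.ofReal t ^ (1 - θ) := by
        rw [← ENNReal.rpow_add _ _ (by simpa using ht.1) ENNReal.ofReal_ne_top]; simp
    _ < _ := ENNReal.mul_lt_mul hx' hy'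

lemma prekopaLeindler_real_of_bounded {θ : ℝ} (h0 : 0 < θ) (h1 : θ < 1)
    {f g h : ℝ → ℝ≥0∞} (hf : Measurable f) (hg : Measurable g) (hh : Measurable h)
    (hf1 : ⨆ x, f x ≠ ⊤) (hg1 : ⨆ x, g x ≠ ⊤)
    (hle : ∀ x y, f x ^ θ * g y ^ (1 - θ) ≤ h (θ • x + (1 - θ) • y)) :
    (∫⁻ x, f x) ^ θ * (∫⁻ x, g x) ^ (1 - θ) ≤ ∫⁻ x, h x := by
  have h1' : 0 < 1 - θ := by linarith
  set a := ⨆ x, f x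
  set b := ⨆ x, g x
  rcases eq_or_ne a 0 with ha | ha
  · have : f = 0 := funext fun x => le_antisymm ((le_iSup f x).trans ha.le) zero_le
    simp [this, h0]
  rcases eq_or_ne b 0 with hb | hb
  · have : g = 0 := funext fun x => le_antisymm ((le_iSup g x).trans hb.le) zero_le
    simp [this, h1]
  -- Dividing `f`, `g`, `h` by `a`, `b`, `c` preserves the hypothesis and normalizes the suprema to
  -- 1; both sides of the conclusion scale by `c⁻¹`.
  set c := a ^ θ * b ^ (1 - θ)
  have hc0 : c ≠ 0 := by simp [c, ha, hb, hf1, hg1]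
  have hct : c ≠ ⊤ := ENNReal.mul_ne_top (ENNReal.rpow_ne_top_of_nonneg h0.le hf1)
    (ENNReal.rpow_ne_top_of_nonneg h1'.le hg1)
  have key := lintegral_arith_mean_le_of_iSup_eq_one h0 h1 (hf.const_mul a⁻¹) (hg.const_mul b⁻¹)
    (hh.const_mul c⁻¹) (by rw [← ENNReal.mul_iSup, ENNReal.inv_mul_cancel ha hf1])
    (by rw [← ENNReal.mul_iSup, ENNReal.inv_mul_cancel hb hg1]) (fun x y => by
      have e : c⁻¹ = a⁻¹ ^ θ * b⁻¹ ^ (1 - θ) := by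
        rw [ENNReal.inv_rpow, ENNReal.inv_rpow, ENNReal.mul_inv]
        · left; simp [ha, hf1]
        · left; exact ENNReal.rpow_ne_top_of_nonneg h0.le hf1
      rw [ENNReal.mul_rpow_of_nonneg _ _ h0.le, ENNReal.mul_rpow_of_nonneg _ _ h1'.le, e,
        mul_mul_mul_comm]
      gcongr
      exact hle x y)
  have key2 := (geom_mean_le_arith_mean_ennreal h0 h1 _ _).trans key
  rw [lintegral_const_mul _ hf, lintegral_const_mul _ hg, lintegral_const_mul _ hh,
    ENNReal.mul_rpow_of_nonneg _ _ h0.le, ENNReal.mul_rpow_of_nonneg _ _ h1'.le,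
    mul_mul_mul_comm, ENNReal.inv_rpow, ENNReal.inv_rpow, ← ENNReal.mul_inv (by simp [ha, hf1])
      (by left; exact ENNReal.rpow_ne_top_of_nonneg h0.le hf1)] at key2
  exact (ENNReal.mul_le_mul_iff_right (ENNReal.inv_ne_zero.2 hct) (ENNReal.inv_ne_top.2 hc0)).1 key2

lemma iSup_lintegral_min_natCast {f : ℝ → ℝ≥0∞} (hf : Measurable f) :
    ⨆ N : ℕ, ∫⁻ x, min (f x) N = ∫⁻ x, f x := by
  rw [← lintegral_iSup (fun N => hf.min measurable_const)
    (fun M N hMN x => by dsimp only; gcongr)]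
  refine lintegral_congr fun x => ?_
  rw [← inf_iSup_eq, ENNReal.iSup_natCast, inf_top_eq]

theorem prekopaLeindler_real : PrekopaLeindler (volume : Measure ℝ) := by
  intro θ h0 h1 f g h hf hg hh hle
  have h1' : 0 < 1 - θ := by linarith
  have iSup_rpow : ∀ (p : ℝ) (_ : 0 < p) (u : ℕ → ℝ≥0∞), (⨆ n, u n) ^ p = ⨆ n, u n ^ p :=
    fun p hp u => (ENNReal.orderIsoRpow p hp).map_iSup u
  rw [← iSup_lintegral_min_natCast hf, ← iSup_lintegral_min_natCast hg, iSup_rpow _ h0,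
    iSup_rpow _ h1', ENNReal.iSup_mul]
  refine iSup_le fun M => ?_
  rw [ENNReal.mul_iSup]
  refine iSup_le fun N => ?_
  refine prekopaLeindler_real_of_bounded h0 h1 (hf.min measurable_const) (hg.min measurable_const)
    hh (ne_top_of_le_ne_top (ENNReal.natCast_ne_top M) (iSup_le fun x => min_le_right _ _))
    (ne_top_of_le_ne_top (ENNReal.natCast_ne_top N) (iSup_le fun x => min_le_right _ _))
    fun x y => le_trans ?_ (hle x y)
  gcongr <;> exact min_le_left _ _

/-- Tensorization: the inequality for `ν` on the fibres is exactly the hypothesis for the marginals,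
to which the inequality for `μ` applies. -/
theorem PrekopaLeindler.prod {E F : Type*} [AddCommGroup E] [Module ℝ E] [MeasurableSpace E]
    [AddCommGroup F] [Module ℝ F] [MeasurableSpace F] {μ : Measure E} {ν : Measure F} [SFinite ν]
    (hμ : PrekopaLeindler μ) (hν : PrekopaLeindler ν) : PrekopaLeindler (μ.prod ν) := by
  intro θ h0 h1 f g h hf hg hh hle
  rw [lintegral_prod _ hf.aemeasurable, lintegral_prod _ hg.aemeasurable,
    lintegral_prod _ hh.aemeasurable]
  refine hμ θ h0 h1 _ _ _ hf.lintegral_prod_right' hg.lintegral_prod_right'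
    hh.lintegral_prod_right' fun x x' => ?_
  exact hν θ h0 h1 _ _ _ (hf.comp measurable_prodMk_left) (hg.comp measurable_prodMk_left)
    (hh.comp measurable_prodMk_left) fun y y' => hle (x, y) (x', y')

theorem PrekopaLeindler.of_measurePreserving {E F : Type*} [AddCommGroup E] [Module ℝ E]
    [MeasurableSpace E] [AddCommGroup F] [Module ℝ F] [MeasurableSpace F] {μ : Measure E}
    {ν : Measure F} (e : E →ₗ[ℝ] F) (he : MeasurePreserving e μ ν) (hμ : PrekopaLeindler μ) :
    PrekopaLeindler ν := by
  intro θ h0 h1 f g h hf hg hh hle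
  rw [← he.lintegral_comp hf, ← he.lintegral_comp hg, ← he.lintegral_comp hh]
  refine hμ θ h0 h1 _ _ _ (hf.comp he.measurable) (hg.comp he.measurable)
    (hh.comp he.measurable) fun x y => ?_
  simpa using hle (e x) (e y)

theorem prekopaLeindler_pi (n : ℕ) : PrekopaLeindler (volume : Measure (Fin n → ℝ)) := by
  induction n with
  | zero =>
    intro θ h0 h1 f g h hf hg hh hle
    rw [volume_pi, Measure.pi_of_empty _ 0, lintegral_dirac, lintegral_dirac, lintegral_dirac]
    simpa using hle 0 0
  | succ n ih =>
    refine (prekopaLeindler_real.prod ih).of_measurePreserving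
      { toFun := fun p => Fin.cons p.1 p.2
        map_add' := fun p q => by ext i; refine Fin.cases ?_ (fun j => ?_) i <;> simp
        map_smul' := fun c p => by ext i; refine Fin.cases ?_ (fun j => ?_) i <;> simp } ?_
    have := (volume_preserving_piFinSuccAbove (fun _ : Fin (n + 1) => ℝ) 0).symm
    refine (congrArg (fun u => MeasurePreserving u _ _) ?_).mp this
    funext p
    exact Fin.insertNth_zero' p.1 p.2

/-- The Prékopa–Leindler inequality on `ℝⁿ`. -/
theorem prekopaLeindler_euclideanSpace (n : ℕ) :
    PrekopaLeindler (volume : Measure (EuclideanSpace ℝ (Fin n))) :=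
  (prekopaLeindler_pi n).of_measurePreserving
    (WithLp.linearEquiv 2 ℝ (Fin n → ℝ)).symm.toLinearMap (PiLp.volume_preserving_toLp (Fin n))

end AffineLogSobolev

namespace AffineLogSobolev

/-! ### The entropy of functions that are Lipschitz with respect to a seminorm -/

variable {n : ℕ} {u : EuclideanSpace ℝ (Fin n) → ℝ} {p : Seminorm ℝ (EuclideanSpace ℝ (Fin n))}

/-- Multiplying `u(θx + (1-θ)y) ≥ u(θx) - (1-θ)p(y)` by `θ` gives the Prékopa–Leindler hypothesis
for `e^{u(θ·)}`, `e^{-p(θ·)}` and `e^{θu}`, since `θp(y) = p(θy)`. The two Jacobians `θ^{-n}`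
combine to the term `-n log θ`. -/
lemma log_integral_exp_mul_ge (hp : Continuous p) (hu : Continuous u)
    (hup : ∀ x y, |u y - u x| ≤ p (y - x)) (hpi : Integrable fun x => Real.exp (-p x))
    (hui : Integrable fun x => Real.exp (u x)) {θ : ℝ} (h0 : 0 < θ) (h1 : θ < 1)
    (hθ : Integrable fun x => Real.exp (θ * u x)) :
    -n * Real.log θ + θ * Real.log (∫ x, Real.exp (u x)) +
      (1 - θ) * Real.log (∫ x, Real.exp (-p x)) ≤ Real.log (∫ x, Real.exp (θ * u x)) := by
  have h1' : 0 < 1 - θ := by linarith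
  have key := prekopaLeindler_euclideanSpace n θ h0 h1
    (fun x => ENNReal.ofReal (Real.exp (u (θ • x))))
    (fun x => ENNReal.ofReal (Real.exp (-p (θ • x))))
    (fun x => ENNReal.ofReal (Real.exp (θ * u x))) (by fun_prop) (by fun_prop) (by fun_prop)
    (fun x y => by
      rw [ENNReal.ofReal_rpow_of_nonneg (by positivity) h0.le,
        ENNReal.ofReal_rpow_of_nonneg (by positivity) h1'.le,
        ← ENNReal.ofReal_mul (by positivity), ← Real.exp_mul, ← Real.exp_mul, ← Real.exp_add]
      refine ENNReal.ofReal_le_ofReal (Real.exp_le_exp.2 ?_)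
      have h := (abs_le.1 (hup (θ • x) (θ • x + (1 - θ) • y))).1
      rw [add_sub_cancel_left, map_smul_eq_mul, Real.norm_eq_abs, abs_of_pos h1'] at h
      rw [map_smul_eq_mul, Real.norm_eq_abs, abs_of_pos h0]
      nlinarith)
  have hm : 0 < ∫ x, Real.exp (u x) := integral_exp_pos hui
  have hc : 0 < ∫ x, Real.exp (-p x) := integral_exp_pos hpi
  have hJ : 0 < ∫ x, Real.exp (θ * u x) := integral_exp_pos hθ
  have hκ : 0 < (θ ^ n)⁻¹ := by positivity
  have e1 : ∫ x, Real.exp (u (θ • x)) = (θ ^ n)⁻¹ * ∫ x, Real.exp (u x) := by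
    rw [Measure.integral_comp_smul volume (fun x => Real.exp (u x)) θ, finrank_euclideanSpace_fin,
      abs_of_pos hκ, smul_eq_mul]
  have e2 : ∫ x, Real.exp (-p (θ • x)) = (θ ^ n)⁻¹ * ∫ x, Real.exp (-p x) := by
    rw [Measure.integral_comp_smul volume (fun x => Real.exp (-p x)) θ,
      finrank_euclideanSpace_fin, abs_of_pos hκ, smul_eq_mul]
  rw [← ofReal_integral_eq_lintegral_ofReal (hui.comp_smul h0.ne')
      (Filter.Eventually.of_forall fun x => by positivity),
    ← ofReal_integral_eq_lintegral_ofReal (hpi.comp_smul h0.ne')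
      (Filter.Eventually.of_forall fun x => by positivity),
    ← ofReal_integral_eq_lintegral_ofReal hθ
      (Filter.Eventually.of_forall fun x => by positivity), e1, e2,
    ENNReal.ofReal_rpow_of_nonneg (by positivity) h0.le,
    ENNReal.ofReal_rpow_of_nonneg (by positivity) h1'.le, ← ENNReal.ofReal_mul (by positivity),
    ENNReal.ofReal_le_ofReal_iff hJ.le] at key
  have := Real.log_le_log (by positivity) key
  rw [Real.log_mul (by positivity) (by positivity), Real.log_rpow (by positivity),
    Real.log_rpow (by positivity), Real.log_mul hκ.ne' hm.ne', Real.log_mul hκ.ne' hc.ne',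
    Real.log_inv, Real.log_pow] at this
  linarith

/-- The decay `u ≤ R - p` makes `e^{θu}` integrable for every `θ > 0`, so `θ ↦ ∫ e^{θu}` is
differentiable at 1 with derivative `∫ u e^u`. -/
lemma integral_mul_exp_le_of_le_sub (hp : Continuous p) (hu : Continuous u)
    (hup : ∀ x y, |u y - u x| ≤ p (y - x)) (hpi : Integrable fun x => Real.exp (-p x))
    {R : ℝ} (hR : ∀ x, u x ≤ R - p x) :
    ∫ x, u x * Real.exp (u x) ≤ (∫ x, Real.exp (u x)) *
      (Real.log (∫ x, Real.exp (u x)) - n - Real.log (∫ x, Real.exp (-p x))) := by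
  have hint : ∀ θ : ℝ, 0 < θ → Integrable fun x => Real.exp (θ * u x) := fun θ h0 => by
    refine ((hpi.comp_smul h0.ne').const_mul (Real.exp (θ * R))).mono'
      (by fun_prop) (Filter.Eventually.of_forall fun x => ?_)
    rw [Real.norm_eq_abs, abs_of_pos (Real.exp_pos _), map_smul_eq_mul, Real.norm_eq_abs,
      abs_of_pos h0, ← Real.exp_add]
    refine Real.exp_le_exp.2 ?_
    nlinarith [hR x]
  have hui : Integrable fun x => Real.exp (u x) := by simpa using hint 1 one_pos
  set m := ∫ x, Real.exp (u x) with hmdef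
  set c := ∫ x, Real.exp (-p x)
  have hm : 0 < m := integral_exp_pos hui
  have hmem : (1 : ℝ) ∈ interior (ProbabilityTheory.integrableExpSet u volume) :=
    mem_interior.2 ⟨Set.Ioi 0, fun θ hθ => hint θ hθ, isOpen_Ioi, Set.mem_Ioi.2 one_pos⟩
  have hd := ProbabilityTheory.hasDerivAt_mgf hmem
  have hm1 : ProbabilityTheory.mgf u volume 1 = m := by simp [ProbabilityTheory.mgf, m]
  set e := ∫ x, u x * Real.exp (u x) with he
  have hd1 : HasDerivAt (ProbabilityTheory.mgf u volume) e 1 := by simpa using hd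
  have hD : HasDerivAt (fun θ : ℝ => Real.log (ProbabilityTheory.mgf u volume θ) -
      (-n * Real.log θ + θ * Real.log m + (1 - θ) * Real.log c))
      (e / m - (-n * 1 + 1 * Real.log m + (0 - 1) * Real.log c)) 1 := by
    have hl := hd1.log (by rw [hm1]; exact hm.ne')
    rw [hm1] at hl
    refine hl.sub (((HasDerivAt.const_mul _ ?_).add ((hasDerivAt_id 1).mul_const _)).add
      (((hasDerivAt_const _ _).sub (hasDerivAt_id 1)).mul_const _))
    simpa using Real.hasDerivAt_log (one_ne_zero)
  have hslope := (hasDerivWithinAt_iff_tendsto_slope' (s := Set.Iio 1) (by simp)).1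
    hD.hasDerivWithinAt
  -- The difference of the two sides vanishes at 1 and is nonnegative on `(0, 1)`, so its left
  -- slopes at 1 are nonpositive.
  have hle := le_of_tendsto hslope (b := 0) (by
    filter_upwards [Ioo_mem_nhdsLT (zero_lt_one' ℝ)] with θ hθ
    rw [slope_def_field, hm1]
    refine div_nonpos_of_nonneg_of_nonpos ?_ (by linarith [hθ.2])
    have := log_integral_exp_mul_ge hp hu hup hpi hui hθ.1 hθ.2 (hint θ hθ.1)
    have e3 : ProbabilityTheory.mgf u volume θ = ∫ x, Real.exp (θ * u x) := rfl
    rw [e3]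
    simp only [Real.log_one]
    linarith)
  have h2 : e / m ≤ Real.log m - n - Real.log c := by linarith
  rw [div_le_iff₀ hm] at h2
  linarith

/-- Domination for the truncations. On `(-∞, -1]` the function `|t|e^t` increases, so `w < -1` needs
only the first term; for `w ≥ -1` the left side is bounded by a constant and `e · e^w ≥ 1`. -/
lemma abs_mul_exp_le_of_le {v w M : ℝ} (hvw : v ≤ w) (hw : w ≤ M) :
    |v * Real.exp v| ≤ |w * Real.exp w| +
      (1 + |M| * Real.exp |M|) * (Real.exp 1 * Real.exp w) := by
  have hB : 1 ≤ 1 + |M| * Real.exp |M| := by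
    have : 0 ≤ |M| * Real.exp |M| := by positivity
    linarith
  rcases le_or_gt (-1) w with h | h
  · have h1 : |v * Real.exp v| ≤ 1 + |M| * Real.exp |M| := by
      rw [abs_mul, abs_of_pos (Real.exp_pos _)]
      rcases le_or_gt 0 v with h0 | h0
      · have : |v| ≤ |M| := abs_le_abs_of_nonneg h0 (hvw.trans hw)
        have h3 : Real.exp v ≤ Real.exp |M| :=
          Real.exp_le_exp.2 ((hvw.trans hw).trans (le_abs_self M))
        have : |v| * Real.exp v ≤ |M| * Real.exp |M| := by gcongr
        linarith
      · rw [abs_of_neg h0]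
        have h3 : -v * Real.exp v ≤ 1 := by
          have h4 := Real.add_one_le_exp (-v)
          calc -v * Real.exp v ≤ Real.exp (-v) * Real.exp v := by gcongr; linarith
            _ = 1 := by rw [← Real.exp_add]; simp
        linarith
    have h2 : 1 ≤ Real.exp 1 * Real.exp w := by
      rw [← Real.exp_add]
      exact Real.one_le_exp (by linarith)
    calc |v * Real.exp v| ≤ 1 + |M| * Real.exp |M| := h1
      _ ≤ (1 + |M| * Real.exp |M|) * (Real.exp 1 * Real.exp w) :=
        le_mul_of_one_le_right (by linarith) h2
      _ ≤ _ := le_add_of_nonneg_left (abs_nonneg _)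
  · have h1 : |v * Real.exp v| ≤ |w * Real.exp w| := by
      rw [abs_mul, abs_mul, abs_of_pos (Real.exp_pos _), abs_of_pos (Real.exp_pos _),
        abs_of_neg (by linarith), abs_of_neg (by linarith)]
      have h2 := Real.add_one_le_exp (w - v)
      have h3 : -v ≤ -w * Real.exp (w - v) := by nlinarith
      calc -v * Real.exp v ≤ -w * Real.exp (w - v) * Real.exp v := by gcongr
        _ = -w * Real.exp w := by rw [mul_assoc, ← Real.exp_add]; simp
    have : 0 ≤ (1 + |M| * Real.exp |M|) * (Real.exp 1 * Real.exp w) := by positivity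
    linarith

/-- The sharp entropy bound for a function that is Lipschitz with respect to a seminorm. -/
theorem integral_mul_exp_le (hp : Continuous p) (hu : Continuous u)
    (hup : ∀ x y, |u y - u x| ≤ p (y - x)) (hpi : Integrable fun x => Real.exp (-p x))
    (hui : Integrable fun x => Real.exp (u x)) (hu1 : ∫ x, Real.exp (u x) = 1)
    {M : ℝ} (hM : ∀ x, u x ≤ M) (huu : Integrable fun x => u x * Real.exp (u x)) :
    ∫ x, u x * Real.exp (u x) ≤ -n - Real.log (∫ x, Real.exp (-p x)) := by
  -- The minimum of two `p`-Lipschitz functions is `p`-Lipschitz, and at each point it equals `u`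
  -- for large `k`.
  set v : ℕ → EuclideanSpace ℝ (Fin n) → ℝ := fun k x => min (u x) (k - p x) with hv
  have hvu : ∀ k x, v k x ≤ u x := fun k x => min_le_left _ _
  have hvc : ∀ k, Continuous (v k) := fun k => by fun_prop
  have hvp : ∀ k x y, |v k y - v k x| ≤ p (y - x) := fun k x y => by
    refine (abs_min_sub_min_le_max _ _ _ _).trans (max_le (hup x y) ?_)
    rw [sub_sub_sub_cancel_left, abs_sub_comm]
    exact abs_sub_map_le_sub p y x
  have hev : ∀ x, ∀ᶠ k in Filter.atTop, v k x = u x := fun x => by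
    filter_upwards [Filter.eventually_ge_atTop ⌈u x + p x⌉₊] with k hk
    have := Nat.ceil_le.1 hk
    exact min_eq_left (by linarith)
  have hlim1 : Filter.Tendsto (fun k => ∫ x, Real.exp (v k x)) Filter.atTop (nhds 1) := by
    rw [← hu1]
    refine tendsto_integral_of_dominated_convergence _
      (fun k => (Real.continuous_exp.comp (hvc k)).aestronglyMeasurable) hui
      (fun k => Filter.Eventually.of_forall fun x => ?_)
      (Filter.Eventually.of_forall fun x => tendsto_nhds_of_eventually_eq ?_)
    · rw [Real.norm_eq_abs, abs_of_pos (Real.exp_pos _)]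
      exact Real.exp_le_exp.2 (hvu k x)
    · filter_upwards [hev x] with k hk
      rw [hk]
  have hlim2 : Filter.Tendsto (fun k => ∫ x, v k x * Real.exp (v k x)) Filter.atTop
      (nhds (∫ x, u x * Real.exp (u x))) := by
    refine tendsto_integral_of_dominated_convergence _
      (fun k => ((hvc k).mul (Real.continuous_exp.comp (hvc k))).aestronglyMeasurable)
      (huu.norm.add ((hui.const_mul (Real.exp 1)).const_mul (1 + |M| * Real.exp |M|)))
      (fun k => Filter.Eventually.of_forall fun x => ?_)
      (Filter.Eventually.of_forall fun x => tendsto_nhds_of_eventually_eq ?_)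
    · exact abs_mul_exp_le_of_le (hvu k x) (hM x)
    · filter_upwards [hev x] with k hk
      rw [hk]
  have hlim3 := hlim1.mul (((hlim1.log one_ne_zero).sub_const (n : ℝ)).sub_const
    (Real.log (∫ x, Real.exp (-p x))))
  have := le_of_tendsto_of_tendsto' hlim2 hlim3 fun k =>
    integral_mul_exp_le_of_le_sub hp (hvc k) (hvp k) hpi fun x => min_le_right _ _
  simpa using this

end AffineLogSobolev

namespace AffineLogSobolev

open scoped NNReal

/-! ### The directional gradient seminorm -/

variable {n : ℕ} {f : EuclideanSpace ℝ (Fin n) → ℝ}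

lemma abs_inner_gradient_le {x ξ : EuclideanSpace ℝ (Fin n)} {c : ℝ} (hc : 0 ≤ c)
    (h : ∀ t : ℝ, |f (x + t • ξ) - f x| ≤ c * |t|) : |inner ℝ (gradient f x) ξ| ≤ c := by
  by_cases hd : DifferentiableAt ℝ f x
  · have h1 : inner ℝ (gradient f x) ξ = fderiv ℝ f x ξ := by
      simp [gradient]
    rw [h1]
    have h2 : HasDerivAt (fun t : ℝ => f (x + t • ξ)) (fderiv ℝ f x ξ) 0 :=
      hd.hasFDerivAt.hasLineDerivAt ξ
    refine h2.le_of_lip' hc (Filter.Eventually.of_forall fun t => ?_)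
    simpa using h t
  -- At points of non-differentiability `gradient` takes the default value 0.
  · simpa [gradient_eq_zero_of_not_differentiableAt hd] using hc

lemma dirGradNorm_le_of_ae_bound {ξ : EuclideanSpace ℝ (Fin n)} {c : ℝ}
    (h : ∀ᵐ x, |inner ℝ (gradient f x) ξ| ≤ c) : dirGradNorm f ξ ≤ ENNReal.ofReal c := by
  rw [dirGradNorm, eLpNorm_exponent_top]
  exact eLpNormEssSup_le_of_ae_bound h

lemma _root_.LipschitzWith.dirGradNorm_le {K : ℝ≥0} (hf : LipschitzWith K f)
    (ξ : EuclideanSpace ℝ (Fin n)) : dirGradNorm f ξ ≤ ENNReal.ofReal (K * ‖ξ‖) := by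
  refine dirGradNorm_le_of_ae_bound (Filter.Eventually.of_forall fun x =>
    abs_inner_gradient_le (by positivity) fun t => ?_)
  have := hf.dist_le_mul (x + t • ξ) x
  rw [Real.dist_eq, dist_eq_norm, add_sub_cancel_left, norm_smul, Real.norm_eq_abs] at this
  linarith

lemma _root_.LipschitzWith.dirGradNorm_ne_top {K : ℝ≥0} (hf : LipschitzWith K f)
    (ξ : EuclideanSpace ℝ (Fin n)) : dirGradNorm f ξ ≠ ⊤ :=
  ne_top_of_le_ne_top ENNReal.ofReal_ne_top (hf.dirGradNorm_le ξ)

lemma ae_abs_inner_gradient_le {ξ : EuclideanSpace ℝ (Fin n)} (h : dirGradNorm f ξ ≠ ⊤) :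
    ∀ᵐ x, |inner ℝ (gradient f x) ξ| ≤ (dirGradNorm f ξ).toReal := by
  have := enorm_ae_le_eLpNormEssSup (fun x => (inner ℝ (gradient f x) ξ : ℝ)) volume
  filter_upwards [this] with x hx
  rw [← eLpNorm_exponent_top] at hx
  have := ENNReal.toReal_mono h hx
  simpa using this

/-- The seminorm `ξ ↦ ‖∇_ξ f‖_∞` of a Lipschitz function. -/
noncomputable def gradSeminorm {K : ℝ≥0} (hf : LipschitzWith K f) :
    Seminorm ℝ (EuclideanSpace ℝ (Fin n)) :=
  Seminorm.of (fun ξ => (dirGradNorm f ξ).toReal)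
    (fun ξ η => by
      refine ENNReal.toReal_le_of_le_ofReal (by positivity) (dirGradNorm_le_of_ae_bound ?_)
      filter_upwards [ae_abs_inner_gradient_le (hf.dirGradNorm_ne_top ξ),
        ae_abs_inner_gradient_le (hf.dirGradNorm_ne_top η)] with x hx hy
      rw [inner_add_right]
      exact (abs_add_le _ _).trans (add_le_add hx hy))
    (fun a ξ => by
      have : dirGradNorm f (a • ξ) = ‖a‖ₑ * dirGradNorm f ξ := by
        rw [dirGradNorm, dirGradNorm, ← eLpNorm_const_smul]
        congr 1
        ext x
        simp [inner_smul_right]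
      simp [this])

lemma gradSeminorm_apply {K : ℝ≥0} (hf : LipschitzWith K f) (ξ : EuclideanSpace ℝ (Fin n)) :
    gradSeminorm hf ξ = (dirGradNorm f ξ).toReal := rfl

lemma gradSeminorm_le {K : ℝ≥0} (hf : LipschitzWith K f) (ξ : EuclideanSpace ℝ (Fin n)) :
    gradSeminorm hf ξ ≤ K * ‖ξ‖ :=
  ENNReal.toReal_le_of_le_ofReal (by positivity) (hf.dirGradNorm_le ξ)

lemma continuous_gradSeminorm {K : ℝ≥0} (hf : LipschitzWith K f) :
    Continuous (gradSeminorm hf) := by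
  refine (LipschitzWith.of_dist_le_mul (K := K) fun x y => ?_).continuous
  rw [Real.dist_eq, dist_eq_norm]
  exact (abs_sub_map_le_sub _ x y).trans (gradSeminorm_le hf _)

/-- A Lipschitz function is Lipschitz with respect to its directional gradient seminorm. -/
theorem abs_sub_le_gradSeminorm {K : ℝ≥0} (hf : LipschitzWith K f)
    (x ξ : EuclideanSpace ℝ (Fin n)) : |f (x + ξ) - f x| ≤ gradSeminorm hf ξ := by
  set N := gradSeminorm hf ξ
  have hgood : ∀ᵐ y, DifferentiableAt ℝ f y ∧ |inner ℝ (gradient f y) ξ| ≤ N :=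
    hf.ae_differentiableAt.and (ae_abs_inner_gradient_le (hf.dirGradNorm_ne_top ξ))
  obtain ⟨G, hG, hGm, hGsub⟩ := hgood.exists_measurable_mem
  have h1 : ∀ᵐ t : ℝ, ∀ᵐ y, y + t • ξ ∈ G := Filter.Eventually.of_forall fun t =>
    (measurePreserving_add_right volume (t • ξ)).quasiMeasurePreserving.ae hG
  -- Rademacher's theorem makes almost every point good; Fubini makes almost every line parallel to
  -- `ξ` good at almost every parameter. On such a line the fundamental theorem of calculus gives
  -- the bound, and continuity of `f` extends it from a dense set of base points.
  have h2 : ∀ᵐ y, ∀ᵐ t : ℝ, y + t • ξ ∈ G := by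
    refine (Measure.ae_ae_comm ?_).1 h1
    exact hGm.preimage (f := fun p : ℝ × EuclideanSpace ℝ (Fin n) => p.2 + p.1 • ξ) (by fun_prop)
  have hfc := hf.continuous
  have hcl : IsClosed {y | |f (y + ξ) - f y| ≤ N} :=
    isClosed_le (by fun_prop) continuous_const
  have hdense : Dense {y | |f (y + ξ) - f y| ≤ N} := by
    refine Measure.dense_of_ae (μ := volume) ?_
    filter_upwards [h2] with y hy
    have hLip : LipschitzWith (K * ‖ξ‖₊) fun t : ℝ => f (y + t • ξ) := by
      refine hf.comp (LipschitzWith.of_dist_le_mul fun s t => ?_)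
      rw [dist_add_left, dist_eq_norm, ← sub_smul, norm_smul, mul_comm, Real.dist_eq]
      simp
    have hftc := (hLip.lipschitzOnWith (s := Set.uIcc 0 1)).absolutelyContinuousOnInterval
      |>.integral_deriv_eq_sub
    have hb := intervalIntegral.norm_integral_le_of_norm_le_const_ae (a := 0) (b := 1) (C := N)
      (f := deriv fun t : ℝ => f (y + t • ξ)) (by
        filter_upwards [hy] with t ht _
        obtain ⟨hd, hN⟩ := hGsub _ ht
        have hder : HasDerivAt (fun t : ℝ => f (y + t • ξ)) (fderiv ℝ f (y + t • ξ) ξ) t := by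
          have := ((hasDerivAt_id t).smul_const ξ).const_add y
          rw [one_smul] at this
          exact hd.hasFDerivAt.comp_hasDerivAt t this
        rw [hder.deriv]
        simpa [gradient] using hN)
    rw [hftc] at hb
    simpa using hb
  exact (hdense.closure_eq ▸ hcl.closure_subset_iff.2 subset_rfl :
    Set.univ ⊆ {y | |f (y + ξ) - f y| ≤ N}) (Set.mem_univ x)

lemma abs_sub_le_gradSeminorm_sub {K : ℝ≥0} (hf : LipschitzWith K f)
    (x y : EuclideanSpace ℝ (Fin n)) : |f y - f x| ≤ gradSeminorm hf (y - x) := by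
  simpa using abs_sub_le_gradSeminorm hf x (y - x)

end AffineLogSobolev

namespace AffineLogSobolev

/-! ### Integration in polar coordinates -/

lemma lintegral_polar {E : Type*} [NormedAddCommGroup E] [NormedSpace ℝ E]
    [FiniteDimensional ℝ E] [Nontrivial E] [MeasurableSpace E] [BorelSpace E] (μ : Measure E)
    [μ.IsAddHaarMeasure] {g : E → ℝ≥0∞} (hg : Measurable g) :
    ∫⁻ x, g x ∂μ = ∫⁻ ξ : Metric.sphere (0 : E) 1, (∫⁻ r in Set.Ioi (0 : ℝ),
      ENNReal.ofReal (r ^ (Module.finrank ℝ E - 1)) * g (r • (ξ : E))) ∂μ.toSphere := by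
  have h0 : ∫⁻ x, g x ∂μ = ∫⁻ x in ({0}ᶜ : Set E), g x ∂μ := by
    rw [← lintegral_add_compl g (measurableSet_singleton (0 : E)),
      setLIntegral_measure_zero _ _ (measure_singleton _), zero_add]
  rw [h0, ← lintegral_subtype_comap (measurableSet_singleton (0 : E)).compl]
  have hmp := (μ.measurePreserving_homeomorphUnitSphereProd)
  have hcont : Continuous fun p : Metric.sphere (0 : E) 1 × Set.Ioi (0 : ℝ) =>
      (p.2 : ℝ) • (p.1 : E) := by fun_prop
  have h1 : ∫⁻ x : ({0}ᶜ : Set E), g x ∂(μ.comap (↑)) =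
      ∫⁻ p : Metric.sphere (0 : E) 1 × Set.Ioi (0 : ℝ), g ((p.2 : ℝ) • (p.1 : E))
        ∂(μ.toSphere.prod (Measure.volumeIoiPow (Module.finrank ℝ E - 1))) := by
    refine Eq.trans ?_ (hmp.lintegral_comp (hg.comp hcont.measurable))
    refine lintegral_congr fun x => ?_
    congr 1
    have := congrArg Subtype.val ((homeomorphUnitSphereProd E).symm_apply_apply x)
    exact this.symm
  rw [h1, lintegral_prod (fun p : Metric.sphere (0 : E) 1 × Set.Ioi (0 : ℝ) =>
    g ((p.2 : ℝ) • (p.1 : E))) (hg.comp hcont.measurable).aemeasurable]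
  refine lintegral_congr fun ξ => ?_
  have hm : Measurable fun r : Set.Ioi (0 : ℝ) => g ((r : ℝ) • (ξ : E)) :=
    hg.comp (by fun_prop)
  rw [Measure.volumeIoiPow, lintegral_withDensity_eq_lintegral_mul _ (by fun_prop) hm,
    ← lintegral_subtype_comap measurableSet_Ioi]
  rfl

lemma lintegral_pow_mul_exp_neg {a : ℝ} (ha : 0 < a) (m : ℕ) :
    ∫⁻ r in Set.Ioi (0 : ℝ), ENNReal.ofReal (r ^ m * Real.exp (-(a * r))) =
      ENNReal.ofReal (m.factorial / a ^ (m + 1)) := by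
  have h := Real.integral_rpow_mul_exp_neg_mul_Ioi (a := m + 1) (by positivity) ha
  rw [Real.Gamma_nat_eq_factorial, add_sub_cancel_right] at h
  simp only [Real.rpow_natCast] at h
  have hval : (1 / a) ^ ((m : ℝ) + 1) * (m.factorial : ℝ) = m.factorial / a ^ (m + 1) := by
    rw [show ((m : ℝ) + 1) = ((m + 1 : ℕ) : ℝ) by push_cast; ring, Real.rpow_natCast]
    rw [one_div, inv_pow, div_eq_mul_inv, mul_comm]
  rw [hval] at h
  rw [← h, ofReal_integral_eq_lintegral_ofReal]
  · by_contra hni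
    have := integral_undef hni
    rw [h] at this
    have : 0 < (m.factorial : ℝ) / a ^ (m + 1) := by positivity
    linarith
  · filter_upwards [ae_restrict_mem measurableSet_Ioi] with r hr
    have : (0 : ℝ) < r := hr
    positivity

variable {n : ℕ}

lemma ofReal_factorial_div_pow {a : ℝ} (ha : 0 < a) (c m : ℕ) :
    ENNReal.ofReal (c / a ^ m) = c * ENNReal.ofReal a ^ (-(m : ℝ)) := by
  rw [div_eq_mul_inv, ENNReal.ofReal_mul (by positivity), ENNReal.ofReal_natCast,
    ENNReal.ofReal_inv_of_pos (by positivity), ENNReal.ofReal_pow ha.le, ENNReal.rpow_neg,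
    ENNReal.rpow_natCast]

/-- `∫ e^{-p} = (n-1)! ∫_{S^{n-1}} p^{-n}` for a seminorm `p`. -/
lemma lintegral_exp_neg_seminorm (hn : 1 ≤ n) (p : Seminorm ℝ (EuclideanSpace ℝ (Fin n)))
    (hp : Continuous p) :
    ∫⁻ x, ENNReal.ofReal (Real.exp (-p x)) = ((n - 1).factorial : ℝ≥0∞) *
      ∫⁻ ξ : Metric.sphere (0 : EuclideanSpace ℝ (Fin n)) 1,
        ENNReal.ofReal (p ξ) ^ (-(n : ℝ)) ∂(volume : Measure _).toSphere := by
  have : Nonempty (Fin n) := ⟨⟨0, hn⟩⟩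
  rw [lintegral_polar volume (by fun_prop), ← lintegral_const_mul' _ _ (ENNReal.natCast_ne_top _)]
  refine lintegral_congr fun ξ => ?_
  have h1 : ∀ r ∈ Set.Ioi (0 : ℝ), ENNReal.ofReal (r ^ (Module.finrank ℝ
      (EuclideanSpace ℝ (Fin n)) - 1)) * ENNReal.ofReal (Real.exp (-p (r • (ξ : _)))) =
      ENNReal.ofReal (r ^ (n - 1) * Real.exp (-(p ξ * r))) := by
    intro r hr
    have hr : 0 < r := hr
    rw [← ENNReal.ofReal_mul (by positivity), finrank_euclideanSpace_fin, map_smul_eq_mul,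
      Real.norm_eq_abs, abs_of_pos hr, mul_comm r]
  rw [setLIntegral_congr_fun measurableSet_Ioi h1]
  rcases (apply_nonneg p (ξ : EuclideanSpace ℝ (Fin n))).eq_or_lt with h0 | hpos
  -- In a direction where `p` vanishes both sides are infinite, since `0 ^ (-n) = ⊤` in `ℝ≥0∞` for
  -- `n ≥ 1`.
  · rw [← h0, ENNReal.ofReal_zero, ENNReal.zero_rpow_of_neg (by
      rw [neg_lt_zero]; exact_mod_cast hn),
      ENNReal.mul_top (by simp [Nat.factorial_ne_zero])]
    rw [eq_top_iff]
    calc (⊤ : ℝ≥0∞) = ∫⁻ r in Set.Ici (1 : ℝ), 1 := by simp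
      _ ≤ ∫⁻ r in Set.Ici (1 : ℝ), ENNReal.ofReal (r ^ (n - 1) * Real.exp (-(0 * r))) := by
          refine setLIntegral_mono' measurableSet_Ici fun r hr => ?_
          simpa using one_le_pow₀ (show (1 : ℝ) ≤ r from hr)
      _ ≤ _ := lintegral_mono_set (Set.Ici_subset_Ioi.2 one_pos)
  · rw [lintegral_pow_mul_exp_neg hpos, ofReal_factorial_div_pow hpos, Nat.sub_add_cancel hn]

/-- `∫ p e^{-p} = n ∫ e^{-p}` for a norm `p` on `ℝⁿ`. -/
lemma lintegral_mul_exp_neg_seminorm (hn : 1 ≤ n) (p : Seminorm ℝ (EuclideanSpace ℝ (Fin n)))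
    (hp : Continuous p) (hpos : ∀ x ≠ 0, 0 < p x) :
    ∫⁻ x, ENNReal.ofReal (p x * Real.exp (-p x)) =
      n * ∫⁻ x, ENNReal.ofReal (Real.exp (-p x)) := by
  have : Nonempty (Fin n) := ⟨⟨0, hn⟩⟩
  rw [lintegral_exp_neg_seminorm hn p hp, lintegral_polar volume (by fun_prop), ← mul_assoc,
    ← Nat.cast_mul, Nat.mul_factorial_pred (by omega),
    ← lintegral_const_mul' _ _ (ENNReal.natCast_ne_top _)]
  refine lintegral_congr fun ξ => ?_
  have hξ : 0 < p ξ := hpos _ (by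
    intro h
    have := mem_sphere_zero_iff_norm.1 ξ.2
    simp [h] at this)
  have h1 : ∀ r ∈ Set.Ioi (0 : ℝ), ENNReal.ofReal (r ^ (Module.finrank ℝ
      (EuclideanSpace ℝ (Fin n)) - 1)) *
        ENNReal.ofReal (p (r • (ξ : _)) * Real.exp (-p (r • (ξ : _)))) =
      ENNReal.ofReal (p ξ) * ENNReal.ofReal (r ^ n * Real.exp (-(p ξ * r))) := by
    intro r hr
    have hr : 0 < r := hr
    rw [← ENNReal.ofReal_mul (by positivity), ← ENNReal.ofReal_mul hξ.le,
      finrank_euclideanSpace_fin, map_smul_eq_mul, Real.norm_eq_abs, abs_of_pos hr,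
      ← mul_pow_sub_one (by omega : n ≠ 0) r, mul_comm r (p ξ)]
    congr 1
    ring
  rw [setLIntegral_congr_fun measurableSet_Ioi h1, lintegral_const_mul' _ _ ENNReal.ofReal_ne_top,
    lintegral_pow_mul_exp_neg hξ, ← ENNReal.ofReal_mul hξ.le, ← ofReal_factorial_div_pow hξ]
  congr 1
  rw [pow_succ]
  field_simp

end AffineLogSobolev

namespace AffineLogSobolev

open scoped NNReal

variable {n : ℕ} {f : EuclideanSpace ℝ (Fin n) → ℝ}

lemma nnreal_smul_seminorm_apply (b : ℝ≥0) (p : Seminorm ℝ (EuclideanSpace ℝ (Fin n)))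
    (x : EuclideanSpace ℝ (Fin n)) : (b • p) x = b * p x := rfl

/-! ### Integrability of `e^{-p}` -/

/-- Integrate `e^{u(x)} e^{-p(y-x)} ≤ e^{u(y)}` over `y` and translate. -/
lemma exp_mul_lintegral_exp_neg_le {u : EuclideanSpace ℝ (Fin n) → ℝ}
    {p : Seminorm ℝ (EuclideanSpace ℝ (Fin n))} (hup : ∀ x y, |u y - u x| ≤ p (y - x))
    (x : EuclideanSpace ℝ (Fin n)) :
    ENNReal.ofReal (Real.exp (u x)) * ∫⁻ y, ENNReal.ofReal (Real.exp (-p y)) ≤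
      ∫⁻ y, ENNReal.ofReal (Real.exp (u y)) := by
  rw [← lintegral_sub_right_eq_self (fun y => ENNReal.ofReal (Real.exp (-p y))) x,
    ← lintegral_const_mul' _ _ ENNReal.ofReal_ne_top]
  refine lintegral_mono fun y => ?_
  rw [← ENNReal.ofReal_mul (by positivity), ← Real.exp_add]
  refine ENNReal.ofReal_le_ofReal (Real.exp_le_exp.2 ?_)
  linarith [(abs_le.1 (hup x y)).1]

lemma integrable_exp_neg_seminorm {u : EuclideanSpace ℝ (Fin n) → ℝ}
    {p : Seminorm ℝ (EuclideanSpace ℝ (Fin n))} (hp : Continuous p)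
    (hup : ∀ x y, |u y - u x| ≤ p (y - x)) (hui : Integrable fun x => Real.exp (u x)) :
    Integrable fun x => Real.exp (-p x) := by
  refine ⟨by fun_prop, ?_⟩
  rw [hasFiniteIntegral_iff_ofReal (Filter.Eventually.of_forall fun x => by positivity)]
  have h1 := (exp_mul_lintegral_exp_neg_le hup 0).trans_lt
    ((hasFiniteIntegral_iff_ofReal (Filter.Eventually.of_forall fun x => by positivity)).1 hui.2)
  exact ENNReal.lt_top_of_mul_ne_top_right h1.ne (by simp [Real.exp_pos])

lemma le_neg_log_integral_exp_neg {u : EuclideanSpace ℝ (Fin n) → ℝ}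
    {p : Seminorm ℝ (EuclideanSpace ℝ (Fin n))}
    (hup : ∀ x y, |u y - u x| ≤ p (y - x)) (hui : Integrable fun x => Real.exp (u x))
    (hpi : Integrable fun x => Real.exp (-p x)) (hu1 : ∫ x, Real.exp (u x) = 1)
    (x : EuclideanSpace ℝ (Fin n)) : u x ≤ -Real.log (∫ x, Real.exp (-p x)) := by
  have h := exp_mul_lintegral_exp_neg_le hup x
  have hc : 0 < ∫ x, Real.exp (-p x) := integral_exp_pos hpi
  rw [← ofReal_integral_eq_lintegral_ofReal hpi
      (Filter.Eventually.of_forall fun x => by positivity),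
    ← ofReal_integral_eq_lintegral_ofReal hui
      (Filter.Eventually.of_forall fun x => by positivity), hu1,
    ← ENNReal.ofReal_mul (by positivity), ENNReal.ofReal_le_ofReal_iff zero_le_one] at h
  have := Real.log_le_log (by positivity) h
  rw [Real.log_mul (Real.exp_pos _).ne' hc.ne', Real.log_exp, Real.log_one] at this
  linarith

/-! ### The affine energy -/

lemma omega_pos (hn : 1 ≤ n) : 0 < omega n :=
  have : Nonempty (Fin n) := ⟨⟨0, hn⟩⟩
  ENNReal.toReal_pos (Metric.measure_ball_pos volume _ one_pos).ne' measure_ball_lt_top.ne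

lemma lintegral_exp_neg_smul_gradSeminorm (hn : 1 ≤ n) {β : ℝ≥0} (hβ : 0 < β) {K : ℝ≥0}
    (hf : LipschitzWith K f) :
    ∫⁻ x, ENNReal.ofReal (Real.exp (-(β • gradSeminorm hf) x)) =
      ((n - 1).factorial : ℝ≥0∞) * (β : ℝ≥0∞) ^ (-(n : ℝ)) *
      ∫⁻ ξ : Metric.sphere (0 : EuclideanSpace ℝ (Fin n)) 1,
        dirGradNorm f (ξ : EuclideanSpace ℝ (Fin n)) ^ (-(n : ℝ))
          ∂(volume : Measure (EuclideanSpace ℝ (Fin n))).toSphere := by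
  have hβ0 : (β : ℝ≥0∞) ≠ 0 := by simpa using hβ.ne'
  rw [lintegral_exp_neg_seminorm hn _ ((continuous_gradSeminorm hf).const_smul β), mul_assoc,
    ← lintegral_const_mul' _ _ (ENNReal.rpow_ne_top_of_ne_zero hβ0 ENNReal.coe_ne_top)]
  congr 1
  refine lintegral_congr fun ξ => ?_
  rw [← ENNReal.mul_rpow_of_ne_top ENNReal.coe_ne_top (hf.dirGradNorm_ne_top _)]
  congr 1
  rw [nnreal_smul_seminorm_apply, gradSeminorm_apply,
    ENNReal.ofReal_mul β.coe_nonneg, ENNReal.ofReal_toReal (hf.dirGradNorm_ne_top _),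
    ENNReal.ofReal_coe_nnreal]

/-- The affine energy of `f` is determined by `∫ e^{-β ‖∇_ξ f‖_∞} dξ`. -/
lemma affineEnergy_spec (hn : 1 ≤ n) {β : ℝ≥0} (hβ : 0 < β) {K : ℝ≥0} (hf : LipschitzWith K f)
    (hi : Integrable fun x => Real.exp (-(β • gradSeminorm hf) x)) :
    0 < affineEnergy f ∧ affineEnergy f < ⊤ ∧
      n * Real.log (β * k n / Real.exp 1 * (affineEnergy f).toReal) =
        -n - Real.log (∫ x, Real.exp (-(β • gradSeminorm hf) x)) := by
  have hn0 : (0 : ℝ) < n := by exact_mod_cast hn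
  have hω := omega_pos hn
  have hβ' : (0 : ℝ) < β := hβ
  set c := ∫ x, Real.exp (-(β • gradSeminorm hf) x)
  have hc : 0 < c := integral_exp_pos hi
  have key := lintegral_exp_neg_smul_gradSeminorm hn hβ hf
  rw [← ofReal_integral_eq_lintegral_ofReal hi
      (Filter.Eventually.of_forall fun x => by positivity)] at key
  rw [affineEnergy]
  set I := ∫⁻ ξ : Metric.sphere (0 : EuclideanSpace ℝ (Fin n)) 1,
        dirGradNorm f (ξ : EuclideanSpace ℝ (Fin n)) ^ (-(n : ℝ))
          ∂(volume : Measure (EuclideanSpace ℝ (Fin n))).toSphere with hI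
  have hβ0 : (β : ℝ≥0∞) ≠ 0 := by simpa using hβ.ne'
  have hcoef : ((n - 1).factorial : ℝ≥0∞) * (β : ℝ≥0∞) ^ (-(n : ℝ)) ≠ 0 := by
    refine mul_ne_zero (by simp [Nat.factorial_ne_zero]) ?_
    simp [ENNReal.rpow_eq_zero_iff, hβ0]
  have hI0 : I ≠ 0 := by
    intro h
    rw [h, mul_zero, ENNReal.ofReal_eq_zero] at key
    linarith
  have hIt : I ≠ ⊤ := by
    intro h
    rw [h, ENNReal.mul_top hcoef] at key
    exact ENNReal.ofReal_ne_top key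
  have hIr : 0 < I.toReal := ENNReal.toReal_pos hI0 hIt
  have hcI : c = (n - 1).factorial * (β : ℝ) ^ (-(n : ℝ)) * I.toReal := by
    have := congrArg ENNReal.toReal key
    rwa [ENNReal.toReal_ofReal hc.le, ENNReal.toReal_mul, ENNReal.toReal_mul,
      ← ENNReal.toReal_rpow, ENNReal.toReal_natCast, ENNReal.coe_toReal] at this
  have hA : 0 < ((n : ℝ) * omega n) ^ (1 / (n : ℝ)) := by positivity
  refine ⟨?_, ?_, ?_⟩
  · refine ENNReal.mul_pos (by simpa using hA) ?_
    simp [ENNReal.rpow_eq_zero_iff, hI0, hIt]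
  · exact ENNReal.mul_lt_top ENNReal.ofReal_lt_top
      (ENNReal.rpow_ne_top_of_ne_zero hI0 hIt).lt_top
  · rw [ENNReal.toReal_mul, ENNReal.toReal_ofReal hA.le, ← ENNReal.toReal_rpow, hcI, k]
    have hfac : (0 : ℝ) < n.factorial := by positivity
    have hfac' : (0 : ℝ) < (n - 1).factorial := by positivity
    -- In the logarithm `ω_n` cancels between `k n` and the prefactor of the energy, and `n! / n`
    -- leaves the `(n-1)!` of the polar formula.
    have hnf : (n.factorial : ℝ) = n * (n - 1).factorial := by
      exact_mod_cast (Nat.mul_factorial_pred (by omega)).symm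
    rw [Real.log_mul (by positivity) (by positivity), Real.log_div (by positivity) (by positivity),
      Real.log_mul (by positivity) (by positivity), Real.log_mul (by positivity) (by positivity),
      Real.log_mul (by positivity) (by positivity), Real.log_mul (by positivity) (by positivity),
      Real.log_rpow (by positivity), Real.log_rpow (by positivity), Real.log_rpow (by positivity),
      Real.log_rpow (by positivity), Real.log_exp, one_div (_ * _), Real.log_inv,
      Real.log_mul (by positivity) (by positivity), Real.log_mul (by positivity) (by positivity),
      hnf, Real.log_mul (by positivity) (by positivity)]
    field_simp
    ring

/-! ### The entropy -/

lemma ent_eq_integral {g : EuclideanSpace ℝ (Fin n) → ℝ}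
    (hg : Integrable fun x => g x * Real.log (g x)) :
    Ent g = ((∫ x, g x * Real.log (g x) : ℝ) : EReal) := by
  have h1 : ∫⁻ x, ENNReal.ofReal (g x * Real.log (g x)) ≠ ⊤ := hg.lintegral_lt_top.ne
  have h2 : ∫⁻ x, ENNReal.ofReal (-(g x * Real.log (g x))) ≠ ⊤ := hg.neg.lintegral_lt_top.ne
  rw [Ent, integral_eq_lintegral_pos_part_sub_lintegral_neg_part hg, EReal.coe_sub,
    EReal.coe_ennreal_toReal h1, EReal.coe_ennreal_toReal h2]

lemma ent_eq_bot {g : EuclideanSpace ℝ (Fin n) → ℝ}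
    (h : ∫⁻ x, ENNReal.ofReal (-(g x * Real.log (g x))) = ⊤) : Ent g = ⊥ := by
  rw [Ent, h, EReal.coe_ennreal_top, EReal.sub_top]

lemma lintegral_ofReal_exp_mul_lt_top {u : EuclideanSpace ℝ (Fin n) → ℝ} {M : ℝ}
    (hui : Integrable fun x => Real.exp (u x)) (hM : ∀ x, u x ≤ M) :
    ∫⁻ x, ENNReal.ofReal (Real.exp (u x) * u x) < ⊤ := by
  refine (lintegral_mono fun x => ENNReal.ofReal_le_ofReal ?_).trans_lt
    (hui.mul_const M).lintegral_lt_top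
  exact mul_le_mul_of_nonneg_left (hM x) (Real.exp_pos _).le

/-- The affine logarithmic Sobolev inequality for Lipschitz functions. -/
theorem ent_le (hn : 1 ≤ n) {β : ℝ≥0} (hβ : 0 < β) {K : ℝ≥0} (hf : LipschitzWith K f)
    (h1 : ∫ x, Real.exp (β * f x) = 1) :
    ∫⁻ x, ENNReal.ofReal (Real.exp (β * f x) * Real.log (Real.exp (β * f x))) < ⊤ ∧
      0 < affineEnergy f ∧ affineEnergy f < ⊤ ∧
      Ent (fun x => Real.exp (β * f x)) ≤
        ((n * Real.log (β * k n / Real.exp 1 * (affineEnergy f).toReal) : ℝ) : EReal) := by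
  set p := β • gradSeminorm hf
  have hp : Continuous p := (continuous_gradSeminorm hf).const_smul β
  have hfc := hf.continuous
  have hup : ∀ x y, |β * f y - β * f x| ≤ p (y - x) := fun x y => by
    rw [← mul_sub, abs_mul, abs_of_nonneg β.coe_nonneg, nnreal_smul_seminorm_apply]
    gcongr
    exact abs_sub_le_gradSeminorm_sub hf x y
  -- A non-integrable function has integral 0 by convention, so normalization to 1 forces
  -- integrability.
  have hui : Integrable fun x => Real.exp (β * f x) := by
    by_contra h
    rw [integral_undef h] at h1
    exact zero_ne_one h1
  have hpi := integrable_exp_neg_seminorm hp hup hui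
  have hM := le_neg_log_integral_exp_neg hup hui hpi h1
  obtain ⟨hE0, hEt, hE⟩ := affineEnergy_spec hn hβ hf hpi
  have hpos : ∫⁻ x, ENNReal.ofReal (Real.exp (β * f x) * (β * f x)) < ⊤ :=
    lintegral_ofReal_exp_mul_lt_top hui hM
  refine ⟨by simpa only [Real.log_exp] using hpos, hE0, hEt, ?_⟩
  rw [hE]
  -- An infinite negative part makes the entropy `⊥`; otherwise it is a genuine Bochner integral.
  by_cases hneg : ∫⁻ x, ENNReal.ofReal
      (-(Real.exp (β * f x) * Real.log (Real.exp (β * f x)))) = ⊤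
  · rw [ent_eq_bot hneg]
    exact bot_le
  have huu : Integrable fun x => Real.exp (β * f x) * (β * f x) := by
    simp only [Real.log_exp] at hneg
    refine ⟨by fun_prop, ?_⟩
    rw [HasFiniteIntegral]
    have : ∀ x, ‖Real.exp (β * f x) * (β * f x)‖ₑ =
        ENNReal.ofReal (Real.exp (β * f x) * (β * f x)) +
          ENNReal.ofReal (-(Real.exp (β * f x) * (β * f x))) := fun x => by
      rw [← ofReal_norm, Real.norm_eq_abs]
      rcases le_total 0 (Real.exp (β * f x) * (β * f x)) with h | h
      · rw [abs_of_nonneg h, ENNReal.ofReal_of_nonpos (neg_nonpos.2 h), add_zero]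
      · rw [abs_of_nonpos h, ENNReal.ofReal_of_nonpos h, zero_add]
    simp only [this]
    rw [lintegral_add_left (by fun_prop)]
    exact ENNReal.add_lt_top.2 ⟨hpos, Ne.lt_top hneg⟩
  rw [ent_eq_integral (by simpa only [Real.log_exp] using huu), EReal.coe_le_coe_iff]
  simp only [Real.log_exp, mul_comm (Real.exp _)]
  exact integral_mul_exp_le hp (by fun_prop) hup hpi hui h1 hM
    (by simpa only [mul_comm (Real.exp _)] using huu)

/-! ### The case of equality -/

/-- After translation, normalization reads `e^c ∫ e^{-p} = 1`, so `c = -log ∫ e^{-p}`; the remaining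
term is `e^c ∫ p e^{-p} = n`. -/
lemma integral_mul_exp_eq (hn : 1 ≤ n) {p : Seminorm ℝ (EuclideanSpace ℝ (Fin n))}
    (hp : Continuous p) (hpos : ∀ x ≠ 0, 0 < p x) {c : ℝ} {x₀ : EuclideanSpace ℝ (Fin n)}
    (h1 : ∫ x, Real.exp (c - p (x - x₀)) = 1) :
    Integrable (fun x => Real.exp (-p x)) ∧
      Integrable (fun x => Real.exp (c - p (x - x₀)) * (c - p (x - x₀))) ∧
      ∫ x, Real.exp (c - p (x - x₀)) * (c - p (x - x₀)) =
        -n - Real.log (∫ x, Real.exp (-p x)) := by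
  have e1 : ∀ x, Real.exp (c - p (x - x₀)) = Real.exp c * Real.exp (-p (x - x₀)) := fun x => by
    rw [← Real.exp_add, sub_eq_add_neg]
  simp only [e1] at h1 ⊢
  rw [integral_const_mul, integral_sub_right_eq_self (fun x => Real.exp (-p x)) x₀] at h1
  have hpi : Integrable fun x => Real.exp (-p x) := by
    by_contra h
    rw [integral_undef h, mul_zero] at h1
    exact zero_ne_one h1
  set C := ∫ x, Real.exp (-p x) with hC
  have hC0 : 0 < C := integral_exp_pos hpi
  have hl := lintegral_mul_exp_neg_seminorm hn p hp hpos
  rw [← ofReal_integral_eq_lintegral_ofReal hpi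
      (Filter.Eventually.of_forall fun x => by positivity), ← hC] at hl
  have hnn : 0 ≤ᵐ[volume] fun x => p x * Real.exp (-p x) :=
    Filter.Eventually.of_forall fun x => mul_nonneg (apply_nonneg p x) (Real.exp_pos _).le
  have hpe : Integrable fun x => p x * Real.exp (-p x) := by
    refine ⟨by fun_prop, ?_⟩
    rw [hasFiniteIntegral_iff_ofReal hnn, hl]
    exact ENNReal.mul_lt_top (ENNReal.natCast_lt_top n) ENNReal.ofReal_lt_top
  have hpv : ∫ x, p x * Real.exp (-p x) = n * C := by
    rw [integral_eq_lintegral_of_nonneg_ae hnn hpe.1, hl, ENNReal.toReal_mul,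
      ENNReal.toReal_ofReal hC0.le, ENNReal.toReal_natCast]
  have hlogC : c = -Real.log C := by
    have := congrArg Real.log h1
    rw [Real.log_mul (Real.exp_pos _).ne' hC0.ne', Real.log_exp, Real.log_one] at this
    linarith
  have e2 : ∀ x, Real.exp c * Real.exp (-p x) * (c - p x) =
      Real.exp c * (c * Real.exp (-p x) - p x * Real.exp (-p x)) := fun x => by ring
  have hint : Integrable fun x => Real.exp c * Real.exp (-p x) * (c - p x) := by
    simp only [e2]
    exact ((hpi.const_mul c).sub hpe).const_mul _
  refine ⟨hpi, hint.comp_sub_right x₀, ?_⟩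
  rw [integral_sub_right_eq_self (fun x => Real.exp c * Real.exp (-p x) * (c - p x)) x₀]
  simp only [e2]
  rw [integral_const_mul, integral_sub (hpi.const_mul c) hpe, integral_const_mul, hpv, ← hC]
  linear_combination (c - n) * h1 + hlogC

/-- No gradient of `q` is computed: the reverse triangle inequality bounds the difference quotients
by `q`, and conversely the increment of `f` from the apex `x₀` to `x₀ + ξ` is exactly `-q ξ`. -/
lemma gradSeminorm_eq_of_forall_eq {K : ℝ≥0} (hf : LipschitzWith K f)
    {q : Seminorm ℝ (EuclideanSpace ℝ (Fin n))} {c : ℝ} {x₀ : EuclideanSpace ℝ (Fin n)}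
    (h : ∀ x, f x = c - q (x - x₀)) : gradSeminorm hf = q := by
  ext ξ
  refine le_antisymm ?_ ?_
  · refine ENNReal.toReal_le_of_le_ofReal (apply_nonneg q ξ) (dirGradNorm_le_of_ae_bound
      (Filter.Eventually.of_forall fun x => abs_inner_gradient_le (apply_nonneg q ξ) fun t => ?_))
    rw [h, h, sub_sub_sub_cancel_left, abs_sub_comm]
    refine (abs_sub_map_le_sub q _ _).trans_eq ?_
    rw [sub_sub_sub_cancel_right, add_sub_cancel_left, map_smul_eq_mul, Real.norm_eq_abs, mul_comm]
  · have := abs_sub_le_gradSeminorm hf x₀ ξ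
    rw [h, h, add_sub_cancel_left, sub_self, map_zero, sub_zero, sub_sub_cancel_left, abs_neg,
      abs_of_nonneg (apply_nonneg q ξ)] at this
    exact this

/-- Equality in the affine logarithmic Sobolev inequality for `f = c - q(· - x₀)`, `q` a norm. -/
theorem ent_eq (hn : 1 ≤ n) {β : ℝ≥0} (hβ : 0 < β) {K : ℝ≥0} (hf : LipschitzWith K f)
    {q : Seminorm ℝ (EuclideanSpace ℝ (Fin n))} (hq : ∀ x ≠ 0, 0 < q x) {c : ℝ}
    {x₀ : EuclideanSpace ℝ (Fin n)} (h : ∀ x, f x = c - q (x - x₀))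
    (h1 : ∫ x, Real.exp (β * f x) = 1) :
    Ent (fun x => Real.exp (β * f x)) =
      ((n * Real.log (β * k n / Real.exp 1 * (affineEnergy f).toReal) : ℝ) : EReal) := by
  have hg := gradSeminorm_eq_of_forall_eq hf h
  have hp : Continuous (β • q) := hg ▸ (continuous_gradSeminorm hf).const_smul β
  have hβ' : (0 : ℝ) < β := hβ
  have e : ∀ x, β * f x = β * c - (β • q) (x - x₀) := fun x => by
    rw [h, mul_sub, nnreal_smul_seminorm_apply]
  simp only [e] at h1 ⊢
  obtain ⟨hpi, hint, hval⟩ := integral_mul_exp_eq hn hp (fun x hx => by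
    rw [nnreal_smul_seminorm_apply]
    exact mul_pos hβ' (hq x hx)) h1
  rw [ent_eq_integral (by simpa only [Real.log_exp] using hint),
    (affineEnergy_spec hn hβ hf (by rw [hg]; exact hpi)).2.2, hg]
  simp only [Real.log_exp]
  rw [hval]

lemma toEuclideanLin_mul_apply (A B : Matrix (Fin n) (Fin n) ℝ) (x : EuclideanSpace ℝ (Fin n)) :
    Matrix.toEuclideanLin A (Matrix.toEuclideanLin B x) = Matrix.toEuclideanLin (A * B) x := by
  simp [Matrix.toLpLin_apply, Matrix.mulVec_mulVec]

end AffineLogSobolev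

/-! ### Conclusion, with linear images of the Euclidean norm as extremals -/

theorem mainTheorem5 (n : ℕ) (hn : 1 ≤ n) (β : ℝ) (hβ : 0 < β) :
    (∀ f : EuclideanSpace ℝ (Fin n) → ℝ,
      (∃ K : NNReal, LipschitzWith K f) →
      (∫ x, Real.exp (β * f x)) = 1 →
        (∫⁻ x, ENNReal.ofReal (Real.exp (β * f x) * Real.log (Real.exp (β * f x)))) < ⊤ ∧
        0 < AffineLogSobolev.affineEnergy f ∧
        AffineLogSobolev.affineEnergy f < ⊤ ∧
        AffineLogSobolev.Ent (fun x => Real.exp (β * f x)) ≤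
          (((n : ℝ) * Real.log (β * AffineLogSobolev.k n / Real.exp 1 *
            (AffineLogSobolev.affineEnergy f).toReal) : ℝ) : EReal)) ∧
    (∀ (a : EuclideanSpace ℝ (Fin n)) (b c : ℝ) (A : Matrix.SpecialLinearGroup (Fin n) ℝ)
      (f : EuclideanSpace ℝ (Fin n) → ℝ),
      0 < b →
      (∀ x, f x = c - b * ‖Matrix.toEuclideanLin (A : Matrix (Fin n) (Fin n) ℝ) x - a‖) →
      (∫ x, Real.exp (β * f x)) = 1 →
        AffineLogSobolev.Ent (fun x => Real.exp (β * f x)) =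
          (((n : ℝ) * Real.log (β * AffineLogSobolev.k n / Real.exp 1 *
            (AffineLogSobolev.affineEnergy f).toReal) : ℝ) : EReal)) := by
  lift β to NNReal using hβ.le
  have hβ' : 0 < β := hβ
  refine ⟨fun f ⟨K, hf⟩ h1 => AffineLogSobolev.ent_le hn hβ' hf h1, fun a b c A f hb h h1 => ?_⟩
  lift b to NNReal using hb.le
  set T := Matrix.toEuclideanLin (A : Matrix (Fin n) (Fin n) ℝ) with hT
  set S := Matrix.toEuclideanLin ((A⁻¹ : Matrix.SpecialLinearGroup (Fin n) ℝ) :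
    Matrix (Fin n) (Fin n) ℝ) with hS
  have hTS : ∀ x, T (S x) = x := fun x => by
    rw [hT, hS, AffineLogSobolev.toEuclideanLin_mul_apply, ← Matrix.SpecialLinearGroup.coe_mul,
      mul_inv_cancel]
    simp
  have hST : ∀ x, S (T x) = x := fun x => by
    rw [hT, hS, AffineLogSobolev.toEuclideanLin_mul_apply, ← Matrix.SpecialLinearGroup.coe_mul,
      inv_mul_cancel]
    simp
  -- Since `A` is invertible, `q x = b|Ax|` is a norm and `b|Ax - a| = q(x - A⁻¹a)`, so the apex is
  -- `A⁻¹a`.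
  set q : Seminorm ℝ (EuclideanSpace ℝ (Fin n)) := b • (normSeminorm ℝ _).comp T with hq
  have hqa : ∀ x, q x = b * ‖T x‖ := fun x => rfl
  have hfq : ∀ x, f x = c - q (x - S a) := fun x => by
    rw [h, hqa, map_sub, hTS]
  have hLip : LipschitzWith (b * ‖T.toContinuousLinearMap‖₊) f := by
    refine LipschitzWith.of_dist_le_mul fun x y => ?_
    rw [Real.dist_eq, hfq, hfq, sub_sub_sub_cancel_left, abs_sub_comm, dist_eq_norm]
    refine (abs_sub_map_le_sub q _ _).trans ?_
    rw [sub_sub_sub_cancel_right, hqa, NNReal.coe_mul, mul_assoc]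
    gcongr
    exact T.toContinuousLinearMap.le_opNorm (x - y)
  refine AffineLogSobolev.ent_eq hn hβ' hLip (fun x hx => ?_) hfq h1
  rw [hqa]
  refine mul_pos hb (norm_pos_iff.2 fun h0 => hx ?_)
  rw [← hST x, h0, map_zero]
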